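/- **Setting.** Let $(M,d)$ be a complete metric space, $1\le p<\infty$, and let $\mathcal P^p(M)$ be the set of Borel probability measures $\mu$ on $M$ with full support (that is, $\mu(\operatorname{supp}\mu)=1$) and $\int_M d(x,y)^p\,d\mu(y)<\infty$ for some $x\in M$, with the $p$-Wasserstein distance $d_p^W(\mu,\nu)=\bigl[\inf_\pi\int_{M\times M}d(x,y)^p\,d\pi(x,y)\bigr]^{1/p}$, the infimum being over all couplings $\pi$ of $\mu$ and $\nu$. Let $\beta:\mathcal P^p(M)\to M$ be a $p$-contractive barycentric map: $\beta(\delta_x)=x$ for all $x\in M$, and $d(\beta(\mu),\beta(\nu))\le d_p^W(\mu,\nu)$ for all $\mu,\nu\in\mathcal P^p(M)$. Let $(\Omega,\mathcal A)$ be a standard Borel space, $\mathbf P$ a probability measure on it, $\mathcal B_1\subset\mathcal B_2\subset\cdots$ an increasing sequence of sub-$\sigma$-algebras of $\mathcal A$, and $\mathcal B_\infty$ the $\sigma$-algebra generated by $\bigcup_n\mathcal B_n$. For a sub-$\sigma$-algebra $\mathcal B\subset\mathcal A$, $L^p(\Omega,\mathcal B,\mathbf P;M)$ is the set of (classes modulo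 a.e. equality of) $\mathcal B$-strongly measurable functions $\varphi:\Omega\to M$ with $\int_\Omega d(x,\varphi)^p\,d\mathbf P<\infty$ for some $x\in M$; write $L^p(\Omega;M)$ when $\mathcal B=\mathcal A$, and $\mathbf d_p(\varphi,\psi)=\bigl[\int_\Omega d(\varphi,\psi)^p\,d\mathbf P\bigr]^{1/p}$. If $(\mathbf P_\omega)_{\omega\in\Omega}$ is the disintegration (regular conditional probability) of $\mathbf P$ with respect to $\mathcal B$, the $\beta$-conditional expectation of $\varphi\in L^p(\Omega;M)$ is $E^\beta_{\mathcal B}(\varphi)(\omega)=\beta(\varphi_*\mathbf P_\omega)$ for a.e. $\omega$. The filtered $\beta$-conditional expectation is $$E^\beta\bigl[\varphi\|(\mathcal B_n)_{n\ge k}\bigr]=\lim_{m\to\infty}E^\beta_{\mathcal B_k}\circ E^\beta_{\mathcal B_{k+1}}\circ\cdots\circ E^\beta_{\mathcal B_m}(\varphi)\in L^p(\Omega,\mathcal B_k,\mathbf P;M)\qquad(\text{limit in }\mathbf d_p).$$ A sequence $(\varphi_k)_{k\ge1}$ is a filtered $\beta$-martingale with respect to $(\mathcal B_n)$ if $\varphi_k\in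 L^p(\Omega,\mathcal B_k,\mathbf P;M)$ and $E^\beta\bigl[\varphi_{k+1}\|(\mathcal B_n)_{n\ge k}\bigr]=\varphi_k$ for all $k\ge1$. **Theorem.** Let $(\varphi_k)_{k\ge1}$ be a filtered $\beta$-martingale with respect to $(\mathcal B_n)_{n\ge1}$. Then the following are equivalent: (i) there exists $\varphi\in L^p(\Omega;M)$ such that $\varphi_k=E^\beta\bigl[\varphi\|(\mathcal B_n)_{n\ge k}\bigr]$ for all $k\ge1$; (ii) there exists $\varphi_\infty\in L^p(\Omega,\mathcal B_\infty,\mathbf P;M)$ such that $\mathbf d_p(\varphi_k,\varphi_\infty)\to0$ as $k\to\infty$. -/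

import Mathlib

open MeasureTheory ProbabilityTheory Filter Topology
open scoped ENNReal

namespace BetaMartingale

section Wasserstein

variable {M : Type*} [MetricSpace M] [MeasurableSpace M]

/-- `μ` belongs to `𝒫ᵖ(M)`: it is a Borel probability measure with full support (its support
has measure one) and it has a finite `p`-th moment about some point. -/
def IsWassersteinMeasure (p : ℝ) (μ : Measure M) : Prop :=
  IsProbabilityMeasure μ ∧ μ μ.supportᶜ = 0 ∧ ∃ x : M, ∫⁻ y, edist x y ^ p ∂μ < ∞

variable (M) in
/-- The set `𝒫ᵖ(M)` as a type. -/
abbrev WassersteinSpace (p : ℝ) : Type _ := {μ : Measure M // IsWassersteinMeasure p μ}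

/-- `π` is a coupling of `μ` and `ν`. As measures in `𝒫ᵖ(M)` live on separable closed sets, it
makes no difference whether a coupling is defined on the product `σ`-algebra (as here) or on the
Borel `σ`-algebra of `M × M`: on products of separable sets the two coincide. -/
def IsCoupling (μ ν : Measure M) (π : Measure (M × M)) : Prop :=
  π.map Prod.fst = μ ∧ π.map Prod.snd = ν

/-- The `p`-Wasserstein distance `d_p^W`. -/
noncomputable def wassersteinDist (p : ℝ) (μ ν : Measure M) : ℝ≥0∞ :=
  (⨅ (π : Measure (M × M)) (_ : IsCoupling μ ν π), ∫⁻ z, edist z.1 z.2 ^ p ∂π) ^ (1 / p)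

/-- `β : 𝒫ᵖ(M) → M` is a `p`-contractive barycentric map: `β(δ_x) = x` for all `x`, and
`d(β(μ), β(ν)) ≤ d_p^W(μ, ν)` for all `μ, ν ∈ 𝒫ᵖ(M)`. -/
def IsContractiveBarycentricMap (p : ℝ) (β : WassersteinSpace M p → M) : Prop :=
  (∀ (x : M) (μ : WassersteinSpace M p), μ.1 = Measure.dirac x → β μ = x) ∧
  ∀ μ ν : WassersteinSpace M p, edist (β μ) (β ν) ≤ wassersteinDist p μ.1 ν.1

/-- Point masses belong to `𝒫ᵖ(M)`, so the first condition above speaks about every `x`. -/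
theorem isWassersteinMeasure_dirac [BorelSpace M] {p : ℝ} (hp : 0 < p) (x : M) :
    IsWassersteinMeasure p (Measure.dirac x) := by
  refine ⟨inferInstance, ?_, x, ?_⟩
  · have hx : x ∈ (Measure.dirac x).support := by
      rw [Measure.mem_support_iff_forall]
      intro U hU
      exact lt_of_lt_of_le (by simp [mem_of_mem_nhds hU]) Measure.le_dirac_apply
    rw [Measure.dirac_apply' _ Measure.isOpen_compl_support.measurableSet]
    simp [hx]
  · rw [lintegral_dirac' _ (by fun_prop)]
    simp [hp]

end Wasserstein

section Lp

variable {Ω M : Type*} {mΩ : MeasurableSpace Ω} [MetricSpace M]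

/-- `φ ∈ Lᵖ(Ω, ℬ, P; M)`: `φ` is (`P`-a.e. equal to) a `ℬ`-strongly measurable function, and
`∫ d(x, φ)ᵖ dP < ∞` for some `x ∈ M`. Elements of `Lᵖ` are represented by functions, to be
identified when they agree almost everywhere. -/
def MemLpOn (p : ℝ) (P : Measure Ω) (ℬ : MeasurableSpace Ω) (φ : Ω → M) : Prop :=
  AEStronglyMeasurable[ℬ] φ P ∧ ∃ x : M, ∫⁻ ω, edist x (φ ω) ^ p ∂P < ∞

/-- The `Lᵖ`-distance `𝐝_p(φ, ψ)`. -/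
noncomputable def lpDist (p : ℝ) (P : Measure Ω) (φ ψ : Ω → M) : ℝ≥0∞ :=
  (∫⁻ ω, edist (φ ω) (ψ ω) ^ p ∂P) ^ (1 / p)

end Lp

section Conditional

open Classical in
/-- The `β`-conditional expectation `E_ℬ^β(φ)(ω) = β(φ_* P_ω)`, where `(P_ω)` is the
disintegration of `P` with respect to `ℬ` (Mathlib's `condExpKernel`). For `φ ∈ Lᵖ` the measure
`φ_* P_ω` lies in `𝒫ᵖ(M)` for almost every `ω`; on the exceptional null set the value is
irrelevant. -/
noncomputable def condExpβ {Ω M : Type*} (ℬ : MeasurableSpace Ω) {mΩ : MeasurableSpace Ω}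
    [StandardBorelSpace Ω] [MetricSpace M] [MeasurableSpace M] {p : ℝ}
    (β : WassersteinSpace M p → M) (P : Measure Ω) [IsFiniteMeasure P] (φ : Ω → M) :
    Ω → M := fun ω ↦
  if h : IsWassersteinMeasure p ((condExpKernel P ℬ ω).map φ) then
    β ⟨(condExpKernel P ℬ ω).map φ, h⟩
  else φ ω

variable {Ω M : Type*} {mΩ : MeasurableSpace Ω} [StandardBorelSpace Ω]
  [MetricSpace M] [MeasurableSpace M]

/-- The iterated conditional expectation
`E^β[φ ‖ (ℬ_n)_{k+j ≥ n ≥ k}] = E_{ℬ_k}^β ∘ E_{ℬ_{k+1}}^β ∘ ⋯ ∘ E_{ℬ_{k+j}}^β (φ)`. -/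
noncomputable def iteratedCondExpβ {p : ℝ} (β : WassersteinSpace M p → M) (P : Measure Ω)
    [IsFiniteMeasure P] (ℬ : ℕ → MeasurableSpace Ω) (φ : Ω → M) : ℕ → ℕ → Ω → M
  | k, 0 => condExpβ (ℬ k) β P φ
  | k, j + 1 => condExpβ (ℬ k) β P (iteratedCondExpβ β P ℬ φ (k + 1) j)

/-- `ψ` is (a version of) the filtered `β`-conditional expectation `E^β[φ ‖ (ℬ_n)_{n ≥ k}]`, i.e.
`ψ ∈ Lᵖ(Ω, ℬ_k, P; M)` and `ψ` is the `𝐝_p`-limit of `E^β[φ ‖ (ℬ_n)_{m ≥ n ≥ k}]` as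
`m → ∞`. (Such a `ψ` is unique up to almost everywhere equality.) -/
def IsFilteredCondExp {p : ℝ} (β : WassersteinSpace M p → M) (P : Measure Ω)
    [IsFiniteMeasure P] (ℬ : ℕ → MeasurableSpace Ω) (k : ℕ) (φ ψ : Ω → M) : Prop :=
  MemLpOn p P (ℬ k) ψ ∧
    Tendsto (fun j ↦ lpDist p P (iteratedCondExpβ β P ℬ φ k j) ψ) atTop (𝓝 0)

/-- `(φ_k)` is a filtered `β`-martingale with respect to `(ℬ_n)`: `φ_k ∈ Lᵖ(Ω, ℬ_k, P; M)` and
`E^β[φ_{k+1} ‖ (ℬ_n)_{n ≥ k}] = φ_k` for every `k`. -/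
def IsFilteredMartingale {p : ℝ} (β : WassersteinSpace M p → M) (P : Measure Ω)
    [IsFiniteMeasure P] (ℬ : ℕ → MeasurableSpace Ω) (φ : ℕ → Ω → M) : Prop :=
  (∀ k, MemLpOn p P (ℬ k) (φ k)) ∧ ∀ k, IsFilteredCondExp β P ℬ k (φ (k + 1)) (φ k)

end Conditional

end BetaMartingale

/-! Everything rests on one estimate: the joint law of two maps couples their laws, so contractivity
of `β`, integrated over the disintegration, makes every `β`-conditional expectation, hence every
finite iterate of them, nonexpansive for `lpDist`.

The other ingredient is Lévy's upward theorem: `E_{ℬ_n} ψ → E_{ℬ_∞} ψ` in `lpDist`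
(`tendsto_lpDist_condExpβ`). For a simple function the conditional law is a point of a finite
simplex; its coordinates converge by the scalar theorem, and `β` is continuous on the simplex
because total variation controls the transport cost. Nonexpansiveness and density of simple
functions give the general case.

(i) ⇒ (ii): conditional expectations fix functions already measurable, so the iterate from `k` to `k
+ j` is at least as close to `E_{ℬ_k} ψ` as `E_{ℬ_{k+j}} ψ` is. Letting `j → ∞` gives `d(φ_k,
E_{ℬ_k} ψ) ≤ d(E_{ℬ_∞} ψ, E_{ℬ_k} ψ)`, hence `d(φ_k, E_{ℬ_∞} ψ) ≤ 2 d(E_{ℬ_k} ψ, E_{ℬ_∞} ψ) → 0`.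

(ii) ⇒ (i): the limit itself serves. A filtered martingale satisfies the one-step identity `E_{ℬ_k}
φ_{k+1} = φ_k`, so the iterate from `k` to `k + j` sends `φ_{k+j+1}` to `φ_k`; being nonexpansive,
it sends the limit to within `d(φ_{k+j+1}, φ_∞)` of `φ_k`. -/

namespace BetaMartingale

/-! ### Pushforward laws and contractivity -/

section Pushforward

variable {X M : Type*} {mX : MeasurableSpace X} [MetricSpace M] [MeasurableSpace M]

/-- A measure concentrated on a separable set is concentrated on its support. -/
theorem measure_compl_support_eq_zero_of_isSeparable {μ : Measure M} {S : Set M}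
    (hS : TopologicalSpace.IsSeparable S) (hμ : μ Sᶜ = 0) : μ μ.supportᶜ = 0 := by
  have hsub : μ.supportᶜ ⊆ (μ.supportᶜ ∩ S) ∪ Sᶜ := fun x hx ↦ by
    by_cases h : x ∈ S <;> simp_all
  refine measure_mono_null hsub (measure_union_null ?_ hμ)
  have hsep : TopologicalSpace.IsSeparable (μ.supportᶜ ∩ S) := hS.mono Set.inter_subset_right
  have := hsep.separableSpace
  have := UniformSpace.secondCountable_of_separable (μ.supportᶜ ∩ S : Set M)
  -- Separable metric spaces are Lindelöf, so countably many of the null neighbourhoods off the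
  -- support already cover this set.
  have hL : IsLindelof (μ.supportᶜ ∩ S) := isLindelof_iff_lindelofSpace.2 inferInstance
  have h0 : (μ.supportᶜ ∩ S)ᶜ ∈ ae μ := by
    refine hL.compl_mem_sets_of_nhdsWithin fun x hx ↦ ?_
    obtain ⟨U, hU, hU0⟩ := Measure.notMem_support_iff_exists.1 hx.1
    exact ⟨U, mem_nhdsWithin_of_mem_nhds hU, by simpa [compl_mem_ae_iff] using hU0⟩
  simpa [compl_mem_ae_iff] using h0

theorem isWassersteinMeasure_map [BorelSpace M] {p : ℝ} {κ : Measure X} [IsProbabilityMeasure κ] {f : X → M}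
    (hf : AEStronglyMeasurable f κ) {x : M} (hx : ∫⁻ y, edist x (f y) ^ p ∂κ < ∞) :
    IsWassersteinMeasure p (κ.map f) := by
  refine ⟨Measure.isProbabilityMeasure_map hf.aemeasurable, ?_, x, ?_⟩
  · have hsep := hf.stronglyMeasurable_mk.isSeparable_range.closure
    refine measure_compl_support_eq_zero_of_isSeparable hsep ?_
    rw [Measure.map_apply_of_aemeasurable hf.aemeasurable isClosed_closure.measurableSet.compl]
    rw [Set.preimage_compl, ← mem_ae_iff]
    filter_upwards [hf.ae_eq_mk] with y hy
    exact subset_closure ⟨y, hy.symm⟩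
  · exact (lintegral_map_le _ _).trans_lt hx

/-- The joint law of `(f, g)` is one of the couplings in the infimum defining the Wasserstein
distance. -/
theorem edist_barycenter_map_rpow_le {p : ℝ} (hp : 0 < p) {β : WassersteinSpace M p → M}
    (hβ : IsContractiveBarycentricMap p β) {κ : Measure X} {f g : X → M}
    (hf : AEMeasurable f κ) (hg : AEMeasurable g κ)
    (hf' : IsWassersteinMeasure p (κ.map f)) (hg' : IsWassersteinMeasure p (κ.map g)) :
    edist (β ⟨κ.map f, hf'⟩) (β ⟨κ.map g, hg'⟩) ^ p ≤ ∫⁻ x, edist (f x) (g x) ^ p ∂κ := by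
  rw [← ENNReal.le_rpow_inv_iff hp, inv_eq_one_div]
  refine (hβ.2 _ _).trans (ENNReal.rpow_le_rpow ?_ (by positivity))
  refine (iInf₂_le (κ.map fun x ↦ (f x, g x)) ⟨?_, ?_⟩).trans (lintegral_map_le _ _)
  · rw [AEMeasurable.map_map_of_aemeasurable measurable_fst.aemeasurable (hf.prodMk hg)]; rfl
  · rw [AEMeasurable.map_map_of_aemeasurable measurable_snd.aemeasurable (hf.prodMk hg)]; rfl

end Pushforward

/-! ### Barycenters of finitely many weighted points -/

section Simplex

variable {F : Type*} [Fintype F] [MeasurableSpace F]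

/-- The measure on a finite type with the given weights. -/
noncomputable def weightMeasure (w : F → ℝ≥0∞) : Measure F :=
  Measure.sum fun x ↦ w x • Measure.dirac x

theorem weightMeasure_singleton [MeasurableSingletonClass F] (w : F → ℝ≥0∞) (x : F) : weightMeasure w {x} = w x := by
  classical simp [weightMeasure, Set.indicator_apply]

theorem weightMeasure_univ (w : F → ℝ≥0∞) : weightMeasure w Set.univ = ∑ x, w x := by
  simp [weightMeasure]

theorem weightMeasure_add [MeasurableSingletonClass F] (v w : F → ℝ≥0∞) :
    weightMeasure (v + w) = weightMeasure v + weightMeasure w := by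
  refine Measure.ext_of_singleton fun x ↦ ?_
  simp [weightMeasure_singleton]

theorem isFiniteMeasure_weightMeasure {w : F → ℝ≥0∞} (hw : ∀ x, w x ≠ ∞) :
    IsFiniteMeasure (weightMeasure w) :=
  ⟨by rw [weightMeasure_univ]; exact ENNReal.sum_lt_top.2 fun x _ ↦ (hw x).lt_top⟩

theorem isProbabilityMeasure_weightMeasure_ofReal (w : stdSimplex ℝ F) :
    IsProbabilityMeasure (weightMeasure fun x ↦ ENNReal.ofReal (w.1 x)) :=
  ⟨by rw [weightMeasure_univ, ← ENNReal.ofReal_sum_of_nonneg fun x _ ↦ w.2.1 x, w.2.2,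
      ENNReal.ofReal_one]⟩

/-- Two probability weights have a coupling whose mass off the diagonal is bounded by their
total variation distance. -/
theorem exists_coupling_weightMeasure [MeasurableSingletonClass F] {v w : F → ℝ≥0∞} (hv : ∑ x, v x = 1) (hw : ∑ x, w x = 1) :
    ∃ π : Measure (F × F), π.map Prod.fst = weightMeasure v ∧ π.map Prod.snd = weightMeasure w ∧
      π {z | z.1 ≠ z.2} ≤ ∑ x, (v x - w x) := by
  have hfin : ∀ {u : F → ℝ≥0∞}, ∑ x, u x = 1 → ∀ x, u x ≠ ∞ := fun {u} hu x h ↦ by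
    have := Finset.single_le_sum (f := u) (fun _ _ ↦ zero_le) (Finset.mem_univ x)
    simp [h, hu] at this
  -- The common part `c` stays in place; the excesses `v - w` and `w - v` have the same total mass
  -- `t`.
  set c : F → ℝ≥0∞ := fun x ↦ min (v x) (w x)
  have hcv : v = c + (v - w) := by
    ext x; simp only [c, Pi.add_apply, Pi.sub_apply]; rw [add_comm, tsub_add_min]
  have hcw : w = c + (w - v) := by
    ext x; simp only [c, Pi.add_apply, Pi.sub_apply]; rw [add_comm, min_comm, tsub_add_min]
  set t := ∑ x, (v x - w x) with ht
  have htop : t ≠ ∞ := by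
    refine ne_top_of_le_ne_top ENNReal.one_ne_top (hv ▸ Finset.sum_le_sum fun x _ ↦ tsub_le_self)
  have ht' : ∑ x, (w x - v x) = t := by
    have h1 : ∑ x, c x + t = 1 := by
      rw [← hv, ht, ← Finset.sum_add_distrib]
      exact Finset.sum_congr rfl fun x _ ↦ (congrFun hcv x).symm
    have h2 : ∑ x, c x + ∑ x, (w x - v x) = 1 := by
      rw [← hw, ← Finset.sum_add_distrib]
      exact Finset.sum_congr rfl fun x _ ↦ (congrFun hcw x).symm
    have hc : ∑ x, c x ≠ ∞ := by
      intro h; simp [h] at h1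
    exact (ENNReal.add_right_inj hc).1 (h2.trans h1.symm)
  have hρ : weightMeasure (v - w) Set.univ = t := weightMeasure_univ _
  have hσ : weightMeasure (w - v) Set.univ = t := (weightMeasure_univ _).trans ht'
  have := isFiniteMeasure_weightMeasure (w := v - w) fun x ↦
    ne_top_of_le_ne_top (hfin hv x) tsub_le_self
  have := isFiniteMeasure_weightMeasure (w := w - v) fun x ↦
    ne_top_of_le_ne_top (hfin hw x) tsub_le_self
  -- If `t = 0` then `t⁻¹ = ∞`, but the measure being scaled is zero.
  have hmul : ∀ μ : Measure F, μ Set.univ = t → t⁻¹ • t • μ = μ := fun μ hμ ↦ by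
    rcases eq_or_ne t 0 with h0 | h0
    · have : μ = 0 := by rw [← Measure.measure_univ_eq_zero, hμ, h0]
      simp [this]
    · rw [smul_smul, ENNReal.inv_mul_cancel h0 htop, one_smul]
  -- The common part sits on the diagonal; the two excesses are coupled independently, with `t⁻¹`
  -- correcting the mass `t * t` of their product.
  refine ⟨(weightMeasure c).map (fun x ↦ (x, x)) +
    t⁻¹ • (weightMeasure (v - w)).prod (weightMeasure (w - v)), ?_, ?_, ?_⟩
  · rw [Measure.map_add _ _ measurable_fst, Measure.map_map measurable_fst (by fun_prop),
      Measure.map_smul, Measure.map_fst_prod, hσ, hmul _ hρ]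
    conv_rhs => rw [hcv, weightMeasure_add]
    congr 1
    exact Measure.map_id
  · rw [Measure.map_add _ _ measurable_snd, Measure.map_map measurable_snd (by fun_prop),
      Measure.map_smul, Measure.map_snd_prod, hρ, hmul _ hσ]
    conv_rhs => rw [hcw, weightMeasure_add]
    congr 1
    exact Measure.map_id
  · rw [Measure.add_apply, Measure.map_apply (by fun_prop) (Set.toFinite _).measurableSet]
    simp only [ne_eq, Set.preimage_ofPred_eq, not_true_eq_false, Set.ofPred_false, measure_empty,
      zero_add, Measure.smul_apply, smul_eq_mul]
    calc t⁻¹ * _ ≤ t⁻¹ * (t * t) := by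
          gcongr
          refine (measure_mono (Set.subset_univ _)).trans ?_
          rw [← Set.univ_prod_univ, Measure.prod_prod, hρ, hσ]
      _ ≤ t := by
          rw [← mul_assoc]
          exact mul_le_of_le_one_left zero_le (ENNReal.inv_mul_le_one t)

variable {M : Type*} [MetricSpace M] [MeasurableSingletonClass F]

theorem lintegral_rpow_lt_top_of_fintype {p : ℝ} (hp : 0 < p) (μ : Measure F) [IsFiniteMeasure μ]
    (e : F → M) (x : M) : ∫⁻ y, edist x (e y) ^ p ∂μ < ∞ := by
  rw [lintegral_fintype]
  exact ENNReal.sum_lt_top.2 fun y _ ↦ ENNReal.mul_lt_top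
    (ENNReal.rpow_lt_top_of_nonneg hp.le (edist_ne_top _ _)) (measure_lt_top _ _)

variable [MeasurableSpace M] [BorelSpace M]

theorem isWassersteinMeasure_map_of_fintype {p : ℝ} (hp : 0 < p) (μ : Measure F)
    [IsProbabilityMeasure μ] (e : F → M) : IsWassersteinMeasure p (μ.map e) := by
  have : Nonempty F := nonempty_of_isProbabilityMeasure μ
  exact isWassersteinMeasure_map (x := e (Classical.arbitrary F))
    (StronglyMeasurable.of_discrete.aestronglyMeasurable)
    (lintegral_rpow_lt_top_of_fintype hp μ e _)

theorem isWassersteinMeasure_simplex {p : ℝ} (hp : 0 < p) (e : F → M) (w : stdSimplex ℝ F) :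
    IsWassersteinMeasure p ((weightMeasure fun x ↦ ENNReal.ofReal (w.1 x)).map e) :=
  have := isProbabilityMeasure_weightMeasure_ofReal w
  isWassersteinMeasure_map_of_fintype hp _ e

/-- The `β`-barycenter of the points `e x` with weights `w x`. -/
noncomputable def simplexBarycenter {p : ℝ} (hp : 0 < p) (β : WassersteinSpace M p → M)
    (e : F → M) (w : stdSimplex ℝ F) : M :=
  β ⟨_, isWassersteinMeasure_simplex hp e w⟩

/-- Only the mass off the diagonal costs anything, and each unit of it costs at most the sum of all
pairwise `p`-th powers. -/
theorem edist_simplexBarycenter_rpow_le {p : ℝ} (hp : 0 < p) {β : WassersteinSpace M p → M}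
    (hβ : IsContractiveBarycentricMap p β) (e : F → M) (v w : stdSimplex ℝ F) :
    edist (simplexBarycenter hp β e v) (simplexBarycenter hp β e w) ^ p ≤
      (∑ z : F × F, edist (e z.1) (e z.2) ^ p) * ∑ x, ENNReal.ofReal (v.1 x - w.1 x) := by
  have h1 (w : stdSimplex ℝ F) : ∑ x, ENNReal.ofReal (w.1 x) = 1 := by
    rw [← ENNReal.ofReal_sum_of_nonneg fun x _ ↦ w.2.1 x, w.2.2, ENNReal.ofReal_one]
  obtain ⟨π, hπ1, hπ2, hπ⟩ := exists_coupling_weightMeasure (h1 v) (h1 w)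
  have hm1 : (weightMeasure fun x ↦ ENNReal.ofReal (v.1 x)).map e = π.map (e ∘ Prod.fst) := by
    rw [← hπ1, Measure.map_map .of_discrete measurable_fst]
  have hm2 : (weightMeasure fun x ↦ ENNReal.ofReal (w.1 x)).map e = π.map (e ∘ Prod.snd) := by
    rw [← hπ2, Measure.map_map .of_discrete measurable_snd]
  have key := edist_barycenter_map_rpow_le hp hβ (κ := π) (f := e ∘ Prod.fst) (g := e ∘ Prod.snd)
    Measurable.of_discrete.aemeasurable Measurable.of_discrete.aemeasurable
    (hm1 ▸ isWassersteinMeasure_simplex hp e v) (hm2 ▸ isWassersteinMeasure_simplex hp e w)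
  simp only [simplexBarycenter, hm1, hm2]
  refine key.trans ?_
  calc ∫⁻ z, edist ((e ∘ Prod.fst) z) ((e ∘ Prod.snd) z) ^ p ∂π
      ≤ ∫⁻ z, Set.indicator {z : F × F | z.1 ≠ z.2}
          (fun _ ↦ ∑ z : F × F, edist (e z.1) (e z.2) ^ p) z ∂π := by
        refine lintegral_mono fun z ↦ ?_
        by_cases hz : z.1 = z.2
        · simp [hz, hp]
        · rw [Set.indicator_of_mem (by exact hz)]
          exact Finset.single_le_sum (f := fun z : F × F ↦ edist (e z.1) (e z.2) ^ p)
            (fun _ _ ↦ zero_le) (Finset.mem_univ z)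
    _ = (∑ z : F × F, edist (e z.1) (e z.2) ^ p) * π {z | z.1 ≠ z.2} :=
        lintegral_indicator_const (Set.toFinite _).measurableSet _
    _ ≤ _ := by
        gcongr
        refine hπ.trans (Finset.sum_le_sum fun x _ ↦ ?_)
        rw [ENNReal.ofReal_sub _ (w.2.1 x)]

/-- This carries measurability and convergence of finitely many weights over to barycenters. -/
theorem continuous_simplexBarycenter {p : ℝ} (hp : 0 < p) {β : WassersteinSpace M p → M}
    (hβ : IsContractiveBarycentricMap p β) (e : F → M) :
    Continuous (simplexBarycenter hp β e) := by
  refine continuous_iff_continuousAt.2 fun w ↦ ?_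
  rw [ContinuousAt, tendsto_iff_edist_tendsto_0]
  have hD : (∑ z : F × F, edist (e z.1) (e z.2) ^ p) ≠ ∞ :=
    (ENNReal.sum_lt_top.2 fun z _ ↦
      ENNReal.rpow_lt_top_of_nonneg hp.le (edist_ne_top _ _)).ne
  have hlim : Tendsto (fun v : stdSimplex ℝ F ↦ ((∑ z : F × F, edist (e z.1) (e z.2) ^ p) *
      ∑ x, ENNReal.ofReal (v.1 x - w.1 x)) ^ p⁻¹) (𝓝 w) (𝓝 0) := by
    have hc : Continuous fun v : stdSimplex ℝ F ↦ ((∑ z : F × F, edist (e z.1) (e z.2) ^ p) *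
        ∑ x, ENNReal.ofReal (v.1 x - w.1 x)) ^ p⁻¹ := by
      refine ENNReal.continuous_rpow_const.comp ((ENNReal.continuous_const_mul hD).comp ?_)
      refine continuous_finsetSum _ fun x _ ↦ ENNReal.continuous_ofReal.comp ?_
      exact ((continuous_apply x).comp continuous_subtype_val).sub continuous_const
    simpa [hp] using hc.tendsto w
  refine tendsto_of_tendsto_of_tendsto_of_le_of_le tendsto_const_nhds hlim (fun _ ↦ zero_le)
    fun v ↦ ?_
  rw [ENNReal.le_rpow_inv_iff hp]
  exact edist_simplexBarycenter_rpow_le hp hβ e v w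

end Simplex

end BetaMartingale

namespace BetaMartingale

/-! ### Laws of simple functions as simplex points -/

section SimpleWeights

variable {Ω M : Type*} {mΩ : MeasurableSpace Ω}

/-- The distribution of a simple function, as a point of the simplex over its range. -/
noncomputable def simpleWeights (s : SimpleFunc Ω M) (κ : Measure Ω) [IsProbabilityMeasure κ] :
    stdSimplex ℝ s.range :=
  ⟨fun x ↦ κ.real (s ⁻¹' {x.1}), fun _ ↦ measureReal_nonneg, by
    rw [s.range.sum_coe_sort fun x ↦ κ.real (s ⁻¹' {x}),
      ← measureReal_biUnion_finset (fun x _ y _ hxy ↦ Disjoint.preimage _ (by simpa using hxy))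
        fun x _ ↦ s.measurableSet_preimage _]
    convert probReal_univ (μ := κ)
    ext ω
    simp⟩

theorem measurable_simpleWeights {Y : Type*} {mY : MeasurableSpace Y} (s : SimpleFunc Ω M)
    (η : Kernel Y Ω) [IsMarkovKernel η] : Measurable fun y ↦ simpleWeights s (η y) :=
  Measurable.subtype_mk (measurable_pi_iff.2 fun _ ↦
    (η.measurable_coe (s.measurableSet_preimage _)).ennreal_toReal)

end SimpleWeights

/-! ### The `Lᵖ` distance and simple approximation -/

section LpDist

variable {Ω M : Type*} {mΩ : MeasurableSpace Ω} [MetricSpace M] {p : ℝ} {P : Measure Ω}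
  {φ ψ χ : Ω → M}

theorem lpDist_comm : lpDist p P φ ψ = lpDist p P ψ φ := by
  simp only [lpDist, edist_comm]

theorem lpDist_triangle (hp : 1 ≤ p) (hφ : AEStronglyMeasurable φ P)
    (hψ : AEStronglyMeasurable ψ P) (hχ : AEStronglyMeasurable χ P) :
    lpDist p P φ χ ≤ lpDist p P φ ψ + lpDist p P ψ χ := by
  refine le_trans ?_ (ENNReal.lintegral_Lp_add_le (hφ.edist hψ) (hψ.edist hχ) hp)
  have : 0 ≤ p := by linarith
  unfold lpDist
  gcongr with ω
  exact edist_triangle _ _ _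

theorem lpDist_le_iff_lintegral {C : ℝ≥0∞} (hp : 0 < p) :
    lpDist p P φ ψ ≤ C ↔ ∫⁻ ω, edist (φ ω) (ψ ω) ^ p ∂P ≤ C ^ p := by
  rw [lpDist, one_div, ENNReal.rpow_inv_le_iff hp]

theorem lpDist_eq_zero_of_ae_eq (hp : 0 < p) (h : φ =ᵐ[P] ψ) : lpDist p P φ ψ = 0 := by
  rw [← nonpos_iff_eq_zero, lpDist_le_iff_lintegral hp, ENNReal.zero_rpow_of_pos hp,
    nonpos_iff_eq_zero]
  refine lintegral_eq_zero_of_ae_eq_zero ?_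
  filter_upwards [h] with ω hω
  simp [hω, hp]

theorem tendsto_lpDist_of_tendsto_lintegral (hp : 0 < p) {ι : Type*} {l : Filter ι}
    {f g : ι → Ω → M}
    (h : Tendsto (fun i ↦ ∫⁻ ω, edist (f i ω) (g i ω) ^ p ∂P) l (𝓝 0)) :
    Tendsto (fun i ↦ lpDist p P (f i) (g i)) l (𝓝 0) := by
  have := (ENNReal.continuous_rpow_const (y := 1 / p)).tendsto 0 |>.comp h
  simpa [hp, lpDist, Function.comp_def] using this

theorem MemLpOn.mono {ℬ ℬ' : MeasurableSpace Ω} (hφ : MemLpOn p P ℬ φ) (h : ℬ ≤ ℬ') :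
    MemLpOn p P ℬ' φ :=
  ⟨hφ.1.mono h, hφ.2⟩

theorem lpDist_congr_left {φ' : Ω → M} (h : φ =ᵐ[P] φ') :
    lpDist p P φ ψ = lpDist p P φ' ψ := by
  unfold lpDist
  congr 1
  refine lintegral_congr_ae ?_
  filter_upwards [h] with ω hω
  rw [hω]

theorem memLpOn_simpleFunc (hp : 0 < p) [IsFiniteMeasure P] [Nonempty Ω] (s : SimpleFunc Ω M) : MemLpOn p P mΩ s := by
  let x := s (Classical.arbitrary Ω)
  refine ⟨s.stronglyMeasurable.aestronglyMeasurable, x, ?_⟩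
  have : ∀ ω, edist x (s ω) ^ p ≤ ∑ y ∈ s.range, edist x y ^ p := fun ω ↦
    Finset.single_le_sum (f := fun y ↦ edist x y ^ p) (fun _ _ ↦ zero_le) (s.mem_range_self ω)
  refine (lintegral_mono this).trans_lt ?_
  rw [lintegral_const]
  exact ENNReal.mul_lt_top (ENNReal.sum_lt_top.2 fun y _ ↦
    ENNReal.rpow_lt_top_of_nonneg hp.le (edist_ne_top _ _)) (measure_lt_top _ _)

variable [MeasurableSpace M] [BorelSpace M]

theorem map_simpleFunc_eq (s : SimpleFunc Ω M) (κ : Measure Ω) [IsProbabilityMeasure κ] :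
    κ.map s = (weightMeasure fun x ↦ ENNReal.ofReal ((simpleWeights s κ).1 x)).map Subtype.val := by
  set sF : Ω → s.range := fun ω ↦ ⟨s ω, s.mem_range_self ω⟩
  have hsF : Measurable sF := s.measurable.subtype_mk
  have h1 : (weightMeasure fun x ↦ ENNReal.ofReal ((simpleWeights s κ).1 x)) = κ.map sF := by
    refine Measure.ext_of_singleton fun x ↦ ?_
    rw [weightMeasure_singleton, Measure.map_apply hsF (measurableSet_singleton x), simpleWeights,
      ofReal_measureReal]
    congr 1
    ext ω
    simp [sF, Subtype.ext_iff]
  rw [h1, Measure.map_map measurable_subtype_coe hsF]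
  rfl

/-- Simple functions approximate a strongly measurable function with finite moment, both in `Lᵖ`
and under every measure with finite moment. -/
theorem exists_simpleFunc_tendsto (hp : 0 < p) {f : Ω → M} (hf : StronglyMeasurable f) (x : M) :
    ∃ s : ℕ → SimpleFunc Ω M, ∀ κ : Measure Ω, ∫⁻ ω, edist x (f ω) ^ p ∂κ < ∞ →
      Tendsto (fun n ↦ ∫⁻ ω, edist (s n ω) (f ω) ^ p ∂κ) atTop (𝓝 0) := by
  -- With `x` as base point, the approximation error is at most `edist x (f ω)`, a dominating
  -- function that serves every `κ` with the same sequence.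
  set S : Set M := Set.range f ∪ {x}
  have hS : TopologicalSpace.IsSeparable S :=
    hf.isSeparable_range.union (Set.finite_singleton x).isSeparable
  have := hS.separableSpace
  have hx : x ∈ S := Or.inr rfl
  refine ⟨SimpleFunc.approxOn f hf.measurable S x hx, fun κ hκ ↦ ?_⟩
  have hlim : ∀ ω, Tendsto (fun n ↦ edist (SimpleFunc.approxOn f hf.measurable S x hx n ω) (f ω) ^ p)
      atTop (𝓝 0) := fun ω ↦ by
    have h1 := SimpleFunc.tendsto_approxOn hf.measurable hx (x := ω)
      (subset_closure (Or.inl ⟨ω, rfl⟩))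
    have := (ENNReal.continuous_rpow_const (y := p)).tendsto 0 |>.comp
      (tendsto_iff_edist_tendsto_0.1 h1)
    simpa [hp, Function.comp_def] using this
  have := tendsto_lintegral_of_dominated_convergence' (μ := κ) (fun ω ↦ edist x (f ω) ^ p)
    (F := fun n ω ↦ edist (SimpleFunc.approxOn f hf.measurable S x hx n ω) (f ω) ^ p) (f := 0)
    (fun n ↦ (((SimpleFunc.stronglyMeasurable _).edist hf).measurable.pow_const p).aemeasurable)
    (fun n ↦ .of_forall fun ω ↦ ENNReal.rpow_le_rpow
      (SimpleFunc.edist_approxOn_le hf.measurable hx ω n) hp.le)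
    hκ.ne (.of_forall hlim)
  simpa using this

end LpDist

/-! ### Integration against the disintegration -/

section Kernel

variable {Ω M : Type*} {ℬ : MeasurableSpace Ω} {mΩ : MeasurableSpace Ω} [StandardBorelSpace Ω]
  {P : Measure Ω} [IsFiniteMeasure P]

theorem ae_trim_ae_condExpKernel (hℬ : ℬ ≤ mΩ) {q : Ω → Prop} (h : ∀ᵐ ω ∂P, q ω) :
    ∀ᵐ ω ∂P.trim hℬ, ∀ᵐ y ∂condExpKernel P ℬ ω, q y :=
  Measure.ae_ae_of_ae_comp (by rwa [condExpKernel_comp_trim hℬ])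

theorem lintegral_trim_condExpKernel (hℬ : ℬ ≤ mΩ) {f : Ω → ℝ≥0∞} (hf : AEMeasurable f P) :
    ∫⁻ ω, ∫⁻ y, f y ∂condExpKernel P ℬ ω ∂P.trim hℬ = ∫⁻ ω, f ω ∂P := by
  conv_rhs => rw [← condExpKernel_comp_trim (μ := P) hℬ]
  rw [Measure.lintegral_bind (Kernel.aemeasurable _) (by rwa [condExpKernel_comp_trim hℬ])]

theorem lintegral_condExpKernel (hℬ : ℬ ≤ mΩ) {f : Ω → ℝ≥0∞} (hf : AEMeasurable f P) :
    ∫⁻ ω, ∫⁻ y, f y ∂condExpKernel P ℬ ω ∂P = ∫⁻ ω, f ω ∂P := by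
  have h1 : ∀ᵐ ω ∂P, ∫⁻ y, f y ∂condExpKernel P ℬ ω = ∫⁻ y, hf.mk f y ∂condExpKernel P ℬ ω := by
    filter_upwards [ae_of_ae_trim hℬ (ae_trim_ae_condExpKernel hℬ hf.ae_eq_mk)] with ω hω
    exact lintegral_congr_ae hω
  rw [lintegral_congr_ae h1, ← lintegral_trim hℬ hf.measurable_mk.lintegral_kernel,
    lintegral_trim_condExpKernel hℬ hf.measurable_mk.aemeasurable]
  exact (lintegral_congr_ae hf.ae_eq_mk).symm

theorem ae_trim_lintegral_condExpKernel_lt_top (hℬ : ℬ ≤ mΩ) {f : Ω → ℝ≥0∞}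
    (hf : AEMeasurable f P) (h : ∫⁻ ω, f ω ∂P < ∞) :
    ∀ᵐ ω ∂P.trim hℬ, ∫⁻ y, f y ∂condExpKernel P ℬ ω < ∞ := by
  have h1 : ∀ᵐ ω ∂P.trim hℬ,
      ∫⁻ y, f y ∂condExpKernel P ℬ ω = ∫⁻ y, hf.mk f y ∂condExpKernel P ℬ ω := by
    filter_upwards [ae_trim_ae_condExpKernel hℬ hf.ae_eq_mk] with ω hω
    exact lintegral_congr_ae hω
  rw [← lintegral_trim_condExpKernel hℬ hf, lintegral_congr_ae h1] at h
  filter_upwards [h1, ae_lt_top hf.measurable_mk.lintegral_kernel h.ne] with ω h2 h3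
  rwa [h2]

variable [MetricSpace M]

/-- A `ℬ`-measurable function is almost surely constant under the conditional laws. -/
theorem ae_ae_condExpKernel_eq (hℬ : ℬ ≤ mΩ) {f : Ω → M} (hf : AEStronglyMeasurable[ℬ] f P) :
    ∀ᵐ ω ∂P, ∀ᵐ y ∂condExpKernel P ℬ ω, f y = f ω := by
  have hmk : StronglyMeasurable[ℬ] (hf.mk f) := hf.stronglyMeasurable_mk
  have hmeas : Measurable[ℬ.prod mΩ] fun z : Ω × Ω ↦ edist (hf.mk f z.1) (hf.mk f z.2) :=
    (StronglyMeasurable.edist (hmk.comp_measurable measurable_fst)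
      ((hmk.mono hℬ).comp_measurable measurable_snd)).measurable
  have hdiag : Measurable[mΩ, ℬ.prod mΩ] (Function.diag : Ω → Ω × Ω) :=
    Measurable.prodMk (measurable_id'' hℬ) measurable_id
  -- The measure `P.trim hℬ ⊗ₘ condExpKernel P ℬ` is the image of `P` under the diagonal map, where
  -- this distance vanishes.
  have h0 : ∀ᵐ z ∂(P.trim hℬ ⊗ₘ condExpKernel P ℬ), edist (hf.mk f z.1) (hf.mk f z.2) = 0 := by
    rw [compProd_trim_condExpKernel hℬ]
    refine (@ae_map_iff Ω (Ω × Ω) mΩ (ℬ.prod mΩ) _ _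
      (@Measurable.aemeasurable _ _ mΩ (ℬ.prod mΩ) _ _ hdiag) _
      (hmeas (measurableSet_singleton 0))).2 ?_
    simp [Function.diag]
  filter_upwards [ae_of_ae_trim hℬ (Measure.ae_ae_of_ae_compProd h0), hf.ae_eq_mk,
    ae_of_ae_trim hℬ (ae_trim_ae_condExpKernel hℬ hf.ae_eq_mk)] with ω h1 h2 h3
  filter_upwards [h1, h3] with y hy1 hy3
  rw [hy3, h2, edist_eq_zero.1 hy1]

end Kernel

/-! ### A single `β`-conditional expectation -/

section Conditional

variable {Ω M : Type*} {ℬ : MeasurableSpace Ω} {mΩ : MeasurableSpace Ω} [StandardBorelSpace Ω]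
  [MetricSpace M] [MeasurableSpace M] [BorelSpace M]
  {P : Measure Ω} [IsFiniteMeasure P] {p : ℝ} {β : WassersteinSpace M p → M} {φ ψ : Ω → M}

theorem ae_trim_isWassersteinMeasure (hℬ : ℬ ≤ mΩ) (hφ : MemLpOn p P mΩ φ) :
    ∀ᵐ ω ∂P.trim hℬ, AEStronglyMeasurable φ (condExpKernel P ℬ ω) ∧
      IsWassersteinMeasure p ((condExpKernel P ℬ ω).map φ) := by
  obtain ⟨hm, x, hx⟩ := hφ
  filter_upwards [ae_trim_ae_condExpKernel hℬ hm.ae_eq_mk,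
    ae_trim_lintegral_condExpKernel_lt_top hℬ
      ((aestronglyMeasurable_const.edist hm).pow_const p) hx] with ω h1 h2
  have h3 : AEStronglyMeasurable φ (condExpKernel P ℬ ω) := ⟨_, hm.stronglyMeasurable_mk, h1⟩
  exact ⟨h3, isWassersteinMeasure_map h3 h2⟩

theorem edist_condExpβ_rpow_le (hp : 0 < p) (hβ : IsContractiveBarycentricMap p β) {ω : Ω}
    (hφ : AEStronglyMeasurable φ (condExpKernel P ℬ ω) ∧
      IsWassersteinMeasure p ((condExpKernel P ℬ ω).map φ))
    (hψ : AEStronglyMeasurable ψ (condExpKernel P ℬ ω) ∧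
      IsWassersteinMeasure p ((condExpKernel P ℬ ω).map ψ)) :
    edist (condExpβ ℬ β P φ ω) (condExpβ ℬ β P ψ ω) ^ p ≤
      ∫⁻ y, edist (φ y) (ψ y) ^ p ∂condExpKernel P ℬ ω := by
  rw [condExpβ, condExpβ, dif_pos hφ.2, dif_pos hψ.2]
  exact edist_barycenter_map_rpow_le hp hβ hφ.1.aemeasurable hψ.1.aemeasurable _ _

theorem lpDist_condExpβ_le (hp : 0 < p) (hβ : IsContractiveBarycentricMap p β) (hℬ : ℬ ≤ mΩ)
    (hφ : MemLpOn p P mΩ φ) (hψ : MemLpOn p P mΩ ψ) :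
    lpDist p P (condExpβ ℬ β P φ) (condExpβ ℬ β P ψ) ≤ lpDist p P φ ψ := by
  refine ENNReal.rpow_le_rpow ?_ (by positivity)
  rw [← lintegral_condExpKernel hℬ ((hφ.1.edist hψ.1).pow_const p)]
  refine lintegral_mono_ae ?_
  filter_upwards [ae_of_ae_trim hℬ (ae_trim_isWassersteinMeasure hℬ hφ),
    ae_of_ae_trim hℬ (ae_trim_isWassersteinMeasure hℬ hψ)] with ω h1 h2
  exact edist_condExpβ_rpow_le hp hβ h1 h2

/-- The conditional law of a `ℬ`-measurable function is almost surely a point mass. -/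
theorem condExpβ_ae_eq_self (hp : 0 < p) (hβ : IsContractiveBarycentricMap p β) (hℬ : ℬ ≤ mΩ)
    (hφ : AEStronglyMeasurable[ℬ] φ P) : condExpβ ℬ β P φ =ᵐ[P] φ := by
  filter_upwards [ae_ae_condExpKernel_eq hℬ hφ] with ω hω
  have h1 : (condExpKernel P ℬ ω).map φ = Measure.dirac (φ ω) := by
    rw [Measure.map_congr hω, Measure.map_const, measure_univ, one_smul]
  rw [condExpβ, dif_pos (h1 ▸ isWassersteinMeasure_dirac hp (φ ω))]
  exact hβ.1 _ _ h1

theorem condExpβ_simpleFunc (hp : 0 < p) (s : SimpleFunc Ω M) (ω : Ω) :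
    condExpβ ℬ β P s ω =
      simplexBarycenter hp β Subtype.val (simpleWeights s (condExpKernel P ℬ ω)) := by
  have h := map_simpleFunc_eq s (condExpKernel P ℬ ω)
  have h' := isWassersteinMeasure_simplex hp (Subtype.val : s.range → M)
    (simpleWeights s (condExpKernel P ℬ ω))
  rw [condExpβ, dif_pos (h ▸ h'), simplexBarycenter]
  simp only [h]

theorem stronglyMeasurable_condExpβ_simpleFunc (hp : 0 < p) (hβ : IsContractiveBarycentricMap p β)
    (s : SimpleFunc Ω M) : StronglyMeasurable[ℬ] (condExpβ ℬ β P s) := by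
  have h : condExpβ ℬ β P s = fun ω ↦
      simplexBarycenter hp β Subtype.val (simpleWeights s (condExpKernel P ℬ ω)) :=
    funext fun ω ↦ condExpβ_simpleFunc hp s ω
  rw [h]
  exact (continuous_simplexBarycenter hp hβ _).stronglyMeasurable.comp_measurable
    (measurable_simpleWeights s (condExpKernel P ℬ))

theorem MemLpOn.condExpβ [Nonempty Ω] (hp : 0 < p) (hβ : IsContractiveBarycentricMap p β)
    (hℬ : ℬ ≤ mΩ) (hφ : MemLpOn p P mΩ φ) : MemLpOn p P ℬ (condExpβ ℬ β P φ) := by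
  have hφ' := hφ
  obtain ⟨hm, x, hx⟩ := hφ
  refine ⟨?_, x, ?_⟩
  · obtain ⟨s, hs⟩ := exists_simpleFunc_tendsto hp hm.stronglyMeasurable_mk x
    -- Convergence is needed almost everywhere for `P.trim hℬ`, not just for `P`, so that the limit
    -- is `ℬ`-measurable up to a null set.
    have hlim : ∀ᵐ ω ∂P.trim hℬ, Tendsto (fun n ↦ BetaMartingale.condExpβ ℬ β P (s n) ω) atTop
        (𝓝 (BetaMartingale.condExpβ ℬ β P φ ω)) := by
      have hall : ∀ᵐ ω ∂P.trim hℬ, ∀ n, AEStronglyMeasurable (s n) (condExpKernel P ℬ ω) ∧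
          IsWassersteinMeasure p ((condExpKernel P ℬ ω).map (s n)) :=
        ae_all_iff.2 fun n ↦ ae_trim_isWassersteinMeasure hℬ (memLpOn_simpleFunc hp (s n))
      filter_upwards [ae_trim_ae_condExpKernel hℬ hm.ae_eq_mk, hall,
        ae_trim_isWassersteinMeasure hℬ hφ', ae_trim_lintegral_condExpKernel_lt_top hℬ
          ((aestronglyMeasurable_const.edist hm).pow_const p) hx] with ω h1 h2 h3 h4
      have h5 : ∫⁻ y, edist x (hm.mk φ y) ^ p ∂condExpKernel P ℬ ω < ∞ := by
        rwa [lintegral_congr_ae (h1.mono fun y hy ↦ by rw [hy])] at h4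
      have h6 := hs _ h5
      have h7 := (ENNReal.continuous_rpow_const (y := 1 / p)).tendsto 0 |>.comp h6
      rw [ENNReal.zero_rpow_of_pos (by positivity)] at h7
      rw [tendsto_iff_edist_tendsto_0]
      refine tendsto_of_tendsto_of_tendsto_of_le_of_le tendsto_const_nhds h7 (fun _ ↦ zero_le)
        fun n ↦ ?_
      rw [Function.comp_apply, one_div, ENNReal.le_rpow_inv_iff hp]
      refine (edist_condExpβ_rpow_le hp hβ (h2 n) h3).trans_eq (lintegral_congr_ae ?_)
      filter_upwards [h1] with y hy
      rw [hy]
    have h := @aestronglyMeasurable_of_tendsto_ae _ _ _ ℬ (P.trim hℬ) _ _ atTop _ _ _ _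
      (fun n ↦ (stronglyMeasurable_condExpβ_simpleFunc hp hβ (s n)).aestronglyMeasurable) hlim
    exact ⟨h.mk _, h.stronglyMeasurable_mk, ae_eq_of_ae_eq_trim h.ae_eq_mk⟩
  -- Constants are fixed, so nonexpansiveness bounds the moment about `x` by that of `φ`.
  · have hc : MemLpOn p P mΩ fun _ : Ω ↦ x :=
      ⟨aestronglyMeasurable_const, x, by simp [hp]⟩
    have h1 := lpDist_condExpβ_le hp hβ hℬ hc hφ'
    have hcc : BetaMartingale.condExpβ ℬ β P (fun _ ↦ x) =ᵐ[P] fun _ ↦ x :=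
      condExpβ_ae_eq_self hp hβ hℬ aestronglyMeasurable_const
    rw [lpDist_congr_left hcc, lpDist_le_iff_lintegral hp] at h1
    refine h1.trans_lt (ENNReal.rpow_lt_top_of_nonneg hp.le ?_)
    exact (ENNReal.rpow_lt_top_of_nonneg (by positivity) hx.ne).ne

end Conditional

end BetaMartingale

namespace BetaMartingale

/-! ### Lévy's theorem, iterates and filtered martingales -/

section Convergence

variable {Ω M : Type*} {mΩ : MeasurableSpace Ω} [StandardBorelSpace Ω]
  [MetricSpace M] [MeasurableSpace M] [BorelSpace M]
  {P : Measure Ω} [IsFiniteMeasure P] {p : ℝ} {β : WassersteinSpace M p → M}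
  {ℬ : ℕ → MeasurableSpace Ω} {φ ψ f : Ω → M}

/-- Scalar martingale convergence applies to the conditional probability of each of the finitely
many level sets; continuity on the simplex does the rest. -/
theorem ae_tendsto_condExpβ_simpleFunc (hp : 0 < p) (hβ : IsContractiveBarycentricMap p β)
    (hℬ : ∀ n, ℬ n ≤ mΩ) (hmono : Monotone ℬ) (s : SimpleFunc Ω M) :
    ∀ᵐ ω ∂P, Tendsto (fun n ↦ condExpβ (ℬ n) β P s ω) atTop
      (𝓝 (condExpβ (⨆ n, ℬ n) β P s ω)) := by
  let ℱ : Filtration ℕ mΩ := ⟨ℬ, hmono, hℬ⟩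
  have h1 : ∀ᵐ ω ∂P, ∀ x : s.range,
      Tendsto (fun n ↦ (condExpKernel P (ℬ n) ω).real (s ⁻¹' {x.1})) atTop
        (𝓝 ((condExpKernel P (⨆ n, ℬ n) ω).real (s ⁻¹' {x.1}))) := by
    refine ae_all_iff.2 fun x ↦ ?_
    have hs := s.measurableSet_preimage {x.1}
    filter_upwards [tendsto_ae_condExp (ℱ := ℱ) ((s ⁻¹' {x.1}).indicator fun _ ↦ (1 : ℝ)),
      ae_all_iff.2 fun n ↦ condExpKernel_ae_eq_condExp (μ := P) (hℬ n) hs,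
      condExpKernel_ae_eq_condExp (μ := P) (iSup_le hℬ) hs] with ω h2 h3 h4
    rw [h4]
    exact h2.congr fun n ↦ (h3 n).symm
  filter_upwards [h1] with ω hω
  simp only [condExpβ_simpleFunc hp]
  refine (continuous_simplexBarycenter hp hβ _).continuousAt.tendsto.comp ?_
  exact tendsto_subtype_rng.2 (tendsto_pi_nhds.2 hω)

theorem tendsto_lpDist_condExpβ_simpleFunc (hp : 0 < p) (hβ : IsContractiveBarycentricMap p β)
    (hℬ : ∀ n, ℬ n ≤ mΩ) (hmono : Monotone ℬ) (s : SimpleFunc Ω M) :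
    Tendsto (fun n ↦ lpDist p P (condExpβ (ℬ n) β P s) (condExpβ (⨆ n, ℬ n) β P s)) atTop
      (𝓝 0) := by
  refine tendsto_lpDist_of_tendsto_lintegral hp ?_
  -- The simplex is compact, so all these barycenters lie in one bounded set, whose diameter
  -- dominates.
  have hbdd := (isCompact_range
    (continuous_simplexBarycenter hp hβ (Subtype.val : s.range → M))).isBounded.ediam_ne_top
  set C := Metric.ediam (Set.range (simplexBarycenter hp β (Subtype.val : s.range → M)))
  have hsm : ∀ {𝒞 : MeasurableSpace Ω}, 𝒞 ≤ mΩ → StronglyMeasurable[mΩ] (condExpβ 𝒞 β P s) :=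
    fun h ↦ (stronglyMeasurable_condExpβ_simpleFunc hp hβ s).mono h
  have := tendsto_lintegral_of_dominated_convergence' (μ := P) (fun _ ↦ C ^ p)
    (F := fun n ω ↦ edist (condExpβ (ℬ n) β P s ω) (condExpβ (⨆ n, ℬ n) β P s ω) ^ p) (f := 0)
    (fun n ↦ (((hsm (hℬ n)).edist (hsm (iSup_le hℬ))).measurable.pow_const p).aemeasurable)
    (fun n ↦ .of_forall fun ω ↦ ENNReal.rpow_le_rpow ?_ hp.le) ?_ ?_
  · simpa using this
  · rw [condExpβ_simpleFunc hp, condExpβ_simpleFunc hp]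
    exact Metric.edist_le_ediam_of_mem ⟨_, rfl⟩ ⟨_, rfl⟩
  · rw [lintegral_const]
    exact ENNReal.mul_ne_top (ENNReal.rpow_lt_top_of_nonneg hp.le hbdd).ne (measure_ne_top _ _)
  · filter_upwards [ae_tendsto_condExpβ_simpleFunc hp hβ hℬ hmono s] with ω hω
    have := (ENNReal.continuous_rpow_const (y := p)).tendsto 0 |>.comp
      (tendsto_iff_edist_tendsto_0.1 hω)
    simpa [hp, Function.comp_def] using this

variable [Nonempty Ω]

/-- Lévy's upward theorem for `β`-conditional expectations. -/
theorem tendsto_lpDist_condExpβ (hp : 1 ≤ p) (hβ : IsContractiveBarycentricMap p β)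
    (hℬ : ∀ n, ℬ n ≤ mΩ) (hmono : Monotone ℬ) (hφ : MemLpOn p P mΩ φ) :
    Tendsto (fun n ↦ lpDist p P (condExpβ (ℬ n) β P φ) (condExpβ (⨆ n, ℬ n) β P φ)) atTop
      (𝓝 0) := by
  have hp0 : 0 < p := by linarith
  have hsup : ⨆ n, ℬ n ≤ mΩ := iSup_le hℬ
  obtain ⟨hm, x, hx⟩ := id hφ
  obtain ⟨s, hs⟩ := exists_simpleFunc_tendsto hp0 hm.stronglyMeasurable_mk x
  have hx' : ∫⁻ ω, edist x (hm.mk φ ω) ^ p ∂P < ∞ := by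
    rwa [lintegral_congr_ae (hm.ae_eq_mk.mono fun y hy ↦ by rw [hy])] at hx
  have happ : Tendsto (fun j ↦ lpDist p P φ (s j)) atTop (𝓝 0) := by
    simp only [lpDist_congr_left hm.ae_eq_mk, lpDist_comm (φ := hm.mk φ)]
    exact tendsto_lpDist_of_tendsto_lintegral hp0 (hs P hx')
  refine ENNReal.tendsto_nhds_zero.2 fun ε hε ↦ ?_
  have hε3 : 0 < ε / 3 := ENNReal.div_pos hε.ne' (by norm_num)
  obtain ⟨j, hj⟩ := (ENNReal.tendsto_nhds_zero.1 happ (ε / 3) hε3).exists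
  have hsL : MemLpOn p P mΩ (s j) := memLpOn_simpleFunc hp0 (s j)
  have hE : ∀ {𝒞 : MeasurableSpace Ω} {χ : Ω → M}, 𝒞 ≤ mΩ → MemLpOn p P mΩ χ →
      AEStronglyMeasurable[mΩ] (condExpβ 𝒞 β P χ) P :=
    fun h hχ ↦ ((hχ.condExpβ hp0 hβ h).mono h).1
  filter_upwards [ENNReal.tendsto_nhds_zero.1
    (tendsto_lpDist_condExpβ_simpleFunc (P := P) hp0 hβ hℬ hmono (s j)) (ε / 3) hε3] with n hn
  calc _ ≤ lpDist p P (condExpβ (ℬ n) β P φ) (condExpβ (ℬ n) β P (s j)) +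
        lpDist p P (condExpβ (ℬ n) β P (s j)) (condExpβ (⨆ n, ℬ n) β P φ) :=
        lpDist_triangle hp (hE (hℬ n) hφ) (hE (hℬ n) hsL) (hE hsup hφ)
    _ ≤ lpDist p P (condExpβ (ℬ n) β P φ) (condExpβ (ℬ n) β P (s j)) +
        (lpDist p P (condExpβ (ℬ n) β P (s j)) (condExpβ (⨆ n, ℬ n) β P (s j)) +
          lpDist p P (condExpβ (⨆ n, ℬ n) β P (s j)) (condExpβ (⨆ n, ℬ n) β P φ)) := by
        gcongr
        exact lpDist_triangle hp (hE (hℬ n) hsL) (hE hsup hsL) (hE hsup hφ)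
    _ ≤ ε / 3 + (ε / 3 + ε / 3) := by
        gcongr
        · exact (lpDist_condExpβ_le hp0 hβ (hℬ n) hφ hsL).trans hj
        · exact (lpDist_condExpβ_le hp0 hβ hsup hsL hφ).trans (lpDist_comm.trans_le hj)
    _ = ε := by rw [← add_assoc, ENNReal.add_thirds]

theorem MemLpOn.iteratedCondExpβ (hp : 0 < p) (hβ : IsContractiveBarycentricMap p β)
    (hℬ : ∀ n, ℬ n ≤ mΩ) (hφ : MemLpOn p P mΩ φ) (k j : ℕ) :
    MemLpOn p P (ℬ k) (iteratedCondExpβ β P ℬ φ k j) := by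
  induction j generalizing k with
  | zero => exact hφ.condExpβ hp hβ (hℬ k)
  | succ j ih => exact ((ih (k + 1)).mono (hℬ _)).condExpβ hp hβ (hℬ k)

theorem lpDist_iteratedCondExpβ_le (hp : 0 < p) (hβ : IsContractiveBarycentricMap p β)
    (hℬ : ∀ n, ℬ n ≤ mΩ) (hφ : MemLpOn p P mΩ φ) (hψ : MemLpOn p P mΩ ψ) (k j : ℕ) :
    lpDist p P (iteratedCondExpβ β P ℬ φ k j) (iteratedCondExpβ β P ℬ ψ k j) ≤
      lpDist p P φ ψ := by
  induction j generalizing k with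
  | zero => exact lpDist_condExpβ_le hp hβ (hℬ k) hφ hψ
  | succ j ih =>
    exact (lpDist_condExpβ_le hp hβ (hℬ k) ((hφ.iteratedCondExpβ hp hβ hℬ _ _).mono (hℬ _))
      ((hψ.iteratedCondExpβ hp hβ hℬ _ _).mono (hℬ _))).trans (ih (k + 1))

/-- On `ℬ_k`-measurable functions, only the innermost conditional expectation matters. -/
theorem lpDist_iteratedCondExpβ_le_of_measurable (hp : 0 < p)
    (hβ : IsContractiveBarycentricMap p β) (hℬ : ∀ n, ℬ n ≤ mΩ) (hmono : Monotone ℬ)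
    (hφ : MemLpOn p P mΩ φ) {k : ℕ} (hf : MemLpOn p P (ℬ k) f) (j : ℕ) :
    lpDist p P (iteratedCondExpβ β P ℬ φ k j) f ≤ lpDist p P (condExpβ (ℬ (k + j)) β P φ) f := by
  induction j generalizing k with
  | zero => exact le_rfl
  | succ j ih =>
    have h1 := lpDist_condExpβ_le (P := P) hp hβ (hℬ k)
      ((hφ.iteratedCondExpβ hp hβ hℬ (k + 1) j).mono (hℬ _)) (hf.mono (hℬ k))
    -- Since `E_{ℬ_k} f = f`, nonexpansiveness strips the outermost expectation; `f` is also
    -- `ℬ_{k+1}`-measurable, so the induction continues.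
    rw [lpDist_comm, lpDist_congr_left (condExpβ_ae_eq_self hp hβ (hℬ k) hf.1), lpDist_comm] at h1
    refine h1.trans ((ih (hf.mono (hmono k.le_succ))).trans_eq ?_)
    rw [Nat.succ_add_eq_add_succ]

/-- The filtered conditional expectation is at least as close to `E_{ℬ_k}^β(ψ)` as
`E_{ℬ_∞}^β(ψ)` is. -/
theorem IsFilteredCondExp.lpDist_le (hp : 1 ≤ p) (hβ : IsContractiveBarycentricMap p β)
    (hℬ : ∀ n, ℬ n ≤ mΩ) (hmono : Monotone ℬ) (hψ : MemLpOn p P mΩ ψ) {k : ℕ}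
    (h : IsFilteredCondExp β P ℬ k ψ φ) :
    lpDist p P φ (condExpβ (ℬ k) β P ψ) ≤
      lpDist p P (condExpβ (⨆ n, ℬ n) β P ψ) (condExpβ (ℬ k) β P ψ) := by
  have hp0 : 0 < p := by linarith
  have hsup : ⨆ n, ℬ n ≤ mΩ := iSup_le hℬ
  have hE : ∀ {𝒞 : MeasurableSpace Ω}, 𝒞 ≤ mΩ → AEStronglyMeasurable[mΩ] (condExpβ 𝒞 β P ψ) P :=
    fun h ↦ ((hψ.condExpβ hp0 hβ h).mono h).1
  have hlim := h.2.add (((tendsto_lpDist_condExpβ hp hβ hℬ hmono hψ).comp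
    (tendsto_add_atTop_nat k)).add_const
      (lpDist p P (condExpβ (⨆ n, ℬ n) β P ψ) (condExpβ (ℬ k) β P ψ)))
  rw [zero_add, zero_add] at hlim
  refine ge_of_tendsto' hlim fun j ↦ ?_
  have hI := ((hψ.iteratedCondExpβ hp0 hβ hℬ k j).mono (hℬ k)).1
  refine (lpDist_triangle hp (h.1.mono (hℬ k)).1 hI (hE (hℬ k))).trans ?_
  rw [lpDist_comm (φ := φ)]
  gcongr
  refine (lpDist_iteratedCondExpβ_le_of_measurable hp0 hβ hℬ hmono hψ
    (hψ.condExpβ hp0 hβ (hℬ k)) j).trans ?_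
  rw [add_comm k j]
  exact lpDist_triangle hp (hE (hℬ _)) (hE hsup) (hE (hℬ k))

/-- Every expectation with index at least `k + 1` fixes `φ (k + 1)`, so its iterates from `k` all
reduce to `E_{ℬ_k}`, and so does their limit. -/
theorem IsFilteredMartingale.lpDist_condExpβ_succ {φ : ℕ → Ω → M} (hp : 1 ≤ p)
    (hβ : IsContractiveBarycentricMap p β) (hℬ : ∀ n, ℬ n ≤ mΩ) (hmono : Monotone ℬ)
    (hφ : IsFilteredMartingale β P ℬ φ) (k : ℕ) :
    lpDist p P (condExpβ (ℬ k) β P (φ (k + 1))) (φ k) = 0 := by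
  have hp0 : 0 < p := by linarith
  have hL : ∀ n, MemLpOn p P mΩ (φ n) := fun n ↦ (hφ.1 n).mono (hℬ n)
  -- The shift by one exposes the outer `E_{ℬ_k}` in every iterate.
  refine nonpos_iff_eq_zero.1 (ge_of_tendsto' ((hφ.2 k).2.comp (tendsto_add_atTop_nat 1))
    fun j ↦ ?_)
  have hI := (hL (k + 1)).iteratedCondExpβ hp0 hβ hℬ (k + 1) j
  have h1 : lpDist p P (condExpβ (ℬ k) β P (φ (k + 1)))
      (iteratedCondExpβ β P ℬ (φ (k + 1)) k (j + 1)) = 0 := by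
    refine nonpos_iff_eq_zero.1 ((lpDist_condExpβ_le hp0 hβ (hℬ k) (hL _)
      (hI.mono (hℬ _))).trans ?_)
    rw [lpDist_comm]
    refine (lpDist_iteratedCondExpβ_le_of_measurable hp0 hβ hℬ hmono (hL _) (hφ.1 _) j).trans ?_
    exact (lpDist_eq_zero_of_ae_eq hp0 (condExpβ_ae_eq_self hp0 hβ (hℬ _)
      ((hφ.1 (k + 1)).1.mono (hmono (Nat.le_add_right _ _))))).le
  refine (lpDist_triangle hp (((hL _).condExpβ hp0 hβ (hℬ k)).mono (hℬ k)).1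
    (((hL (k + 1)).iteratedCondExpβ hp0 hβ hℬ k (j + 1)).mono (hℬ k)).1 (hL k).1).trans_eq ?_
  rw [h1, zero_add]
  rfl

/-- The innermost expectation is `E_{ℬ_{k+j}}`, which takes `φ (k + j + 1)` to `φ (k + j)`; each
further one lowers the index by one. -/
theorem IsFilteredMartingale.lpDist_iteratedCondExpβ {φ : ℕ → Ω → M} (hp : 1 ≤ p)
    (hβ : IsContractiveBarycentricMap p β) (hℬ : ∀ n, ℬ n ≤ mΩ) (hmono : Monotone ℬ)
    (hφ : IsFilteredMartingale β P ℬ φ) (k j : ℕ) :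
    lpDist p P (iteratedCondExpβ β P ℬ (φ (k + j + 1)) k j) (φ k) = 0 := by
  have hp0 : 0 < p := by linarith
  have hL : ∀ n, MemLpOn p P mΩ (φ n) := fun n ↦ (hφ.1 n).mono (hℬ n)
  induction j generalizing k with
  | zero => exact hφ.lpDist_condExpβ_succ hp hβ hℬ hmono k
  | succ j ih =>
    have hI := ((hL (k + (j + 1) + 1)).iteratedCondExpβ hp0 hβ hℬ (k + 1) j).mono (hℬ _)
    refine nonpos_iff_eq_zero.1 ((lpDist_triangle hp
      (((hI.condExpβ hp0 hβ (hℬ k))).mono (hℬ k)).1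
      (((hL (k + 1)).condExpβ hp0 hβ (hℬ k)).mono (hℬ k)).1 (hL k).1).trans ?_)
    rw [hφ.lpDist_condExpβ_succ hp hβ hℬ hmono k, add_zero]
    refine (lpDist_condExpβ_le hp0 hβ (hℬ k) hI (hL _)).trans ?_
    have := ih (k + 1)
    rw [show k + 1 + j + 1 = k + (j + 1) + 1 by ring] at this
    exact this.le

end Convergence

end BetaMartingale

/-! ### The equivalence -/

theorem theorem3p6 {Ω M : Type*} {mΩ : MeasurableSpace Ω} [StandardBorelSpace Ω]
    [MetricSpace M] [CompleteSpace M] [MeasurableSpace M] [BorelSpace M]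
    (P : Measure Ω) [IsProbabilityMeasure P]
    (p : ℝ) (hp : 1 ≤ p)
    (β : BetaMartingale.WassersteinSpace M p → M)
    (hβ : BetaMartingale.IsContractiveBarycentricMap p β)
    (ℬ : ℕ → MeasurableSpace Ω) (hℬ : ∀ n, ℬ n ≤ mΩ) (hmono : Monotone ℬ)
    (φ : ℕ → Ω → M) (hφ : BetaMartingale.IsFilteredMartingale β P ℬ φ) :
    (∃ ψ : Ω → M, BetaMartingale.MemLpOn p P mΩ ψ ∧
      ∀ k, BetaMartingale.IsFilteredCondExp β P ℬ k ψ (φ k)) ↔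
    (∃ φ_lim : Ω → M, BetaMartingale.MemLpOn p P (⨆ n, ℬ n) φ_lim ∧
      Tendsto (fun k ↦ BetaMartingale.lpDist p P (φ k) φ_lim) atTop (𝓝 0)) := by
  have hp0 : 0 < p := by linarith
  have hsup : ⨆ n, ℬ n ≤ mΩ := iSup_le hℬ
  have hL : ∀ n, BetaMartingale.MemLpOn p P mΩ (φ n) := fun n ↦ (hφ.1 n).mono (hℬ n)
  have : Nonempty Ω := nonempty_of_isProbabilityMeasure P
  constructor
  · rintro ⟨ψ, hψ, h⟩
    refine ⟨BetaMartingale.condExpβ (⨆ n, ℬ n) β P ψ, hψ.condExpβ hp0 hβ hsup, ?_⟩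
    have hlim := BetaMartingale.tendsto_lpDist_condExpβ hp hβ hℬ hmono hψ
    have hlim2 := hlim.add hlim
    -- Two copies of the Lévy error: one for `d(φ_k, E_{ℬ_k} ψ)`, one for `d(E_{ℬ_k} ψ, E_{ℬ_∞} ψ)`.
    rw [add_zero] at hlim2
    refine tendsto_of_tendsto_of_tendsto_of_le_of_le tendsto_const_nhds hlim2 (fun _ ↦ zero_le)
      fun k ↦ ?_
    refine (BetaMartingale.lpDist_triangle hp (hL k).1
      ((hψ.condExpβ hp0 hβ (hℬ k)).mono (hℬ k)).1
      ((hψ.condExpβ hp0 hβ hsup).mono hsup).1).trans ?_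
    gcongr
    exact ((h k).lpDist_le hp hβ hℬ hmono hψ).trans_eq BetaMartingale.lpDist_comm
  · rintro ⟨ψ, hψ, h⟩
    have hψ' := hψ.mono hsup
    refine ⟨ψ, hψ', fun k ↦ ⟨hφ.1 k, ?_⟩⟩
    refine tendsto_of_tendsto_of_tendsto_of_le_of_le tendsto_const_nhds
      (h.comp (tendsto_add_atTop_nat (k + 1))) (fun _ ↦ zero_le) fun j ↦ ?_
    -- The intermediate point is the same iterate applied to `φ (k + j + 1)`, which is `φ k` almost
    -- everywhere.
    refine (BetaMartingale.lpDist_triangle hp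
      ((hψ'.iteratedCondExpβ hp0 hβ hℬ k j).mono (hℬ k)).1
      (((hL (k + j + 1)).iteratedCondExpβ hp0 hβ hℬ k j).mono (hℬ k)).1 (hL k).1).trans ?_
    rw [hφ.lpDist_iteratedCondExpβ hp hβ hℬ hmono k j, add_zero]
    refine (BetaMartingale.lpDist_iteratedCondExpβ_le hp0 hβ hℬ hψ' (hL _) k j).trans_eq ?_
    rw [BetaMartingale.lpDist_comm, Function.comp_apply, show j + (k + 1) = k + j + 1 by ring]
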